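/- Let $k\ge 2$ be an integer and let $F$ be a finite simple graph with $m$ edges and no isolated vertices. Let $r_k(F)$ denote the multicolor Ramsey number of $F$, that is, the least integer $n\ge 0$ such that every coloring of the edges of the complete graph $K_n$ with $k$ colors contains a monochromatic (not necessarily induced) copy of $F$. Then $r_k(F)$ exists and $$ r_k(F)\le k^{6km^{2/3}}. $$ -/

import Mathlib

/-- Every coloring of the edges of the complete graph on `n` vertices with `k` colors contains a
monochromatic copy of `F`, that is, a (not necessarily induced) copy of `F` in the graph formed by
the edges of one of the colors. -/
def RamseyArrows (k : ℕ) {V : Type*} (F : SimpleGraph V) (n : ℕ) : Prop :=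
  ∀ C : SimpleGraph.TopEdgeLabeling (Fin n) (Fin k),
    ∃ c : Fin k, SimpleGraph.IsContained F (C.labelGraph c)

/-- The multicolor Ramsey number `r_k(F)`: the least `n` such that every `k`-coloring of the edges
of the complete graph on `n` vertices contains a monochromatic copy of `F`. (The value is `0` if
there is no such `n`; existence is claimed separately where the number is used.) -/
noncomputable def multicolorRamseyNumber (k : ℕ) {V : Type*} (F : SimpleGraph V) : ℕ :=
  sInf {n : ℕ | RamseyArrows k F n}

/-!
Let `m` be the number of edges of `F`, let `D` be about `m ^ (1 / 3)`, and let `s ≤ 2 * m / (D + 1)`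
be the number of vertices of `F` of degree greater than `D`. The remaining vertices span a graph of
maximum degree at most `D`, hence properly colorable with `D + 1` colors. A color `c` of the edges
of the complete graph contains `F` as soon as it has

* a clique `K` with `s` vertices, joined completely to a set `X`, and
* a chain of `D + 1` sets inside `X`, the last one large, such that any `D` vertices of one set have
  many common neighbors in the set before it (`SimpleGraph.Tower`).

Indeed the vertices of large degree go to `K`, and the others are embedded greedily, one class of
their proper coloring in each set of the chain, from the last set to the first
(`SimpleGraph.IsStage.isContained`).

All colors try to build this structure at the same time, inside a shrinking vertex set `Y`. A color
whose clique is incomplete makes progress if some vertex has at least `#Y / k` neighbors of this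
color in `Y`: these neighbors become the new `Y`, which costs a factor `k`. If this is impossible
for all such colors, then at every vertex of `Y` the remaining colors, whose cliques are complete,
have degree at least `#Y / k` on average, and dependent random choice yields a new level for one of
them at the cost of a factor `k ^ (D + 1)` (`SimpleGraph.exists_color_isRichIn`). As a color needs
`s` steps of the first kind and `D` of the second, the process ends successfully if there are
`k ^ (k * (s + (D + 1) * D)) * (2 * m) ^ (D + 1)` vertices at the start
(`SimpleGraph.exists_isStage_zero`). The exponents `s` and `(D + 1) * D` are balanced at
`m ^ (2 / 3)` by the choice of `D`, and the last factor is of lower order.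
-/

/-! ### Two finite sums -/

open Finset in
theorem sum_piFinset_card_filter_forall {β W : Type*} (t : ℕ) (B : Finset β) (Y : Finset W)
    (r : β → W → Prop) [∀ x, DecidablePred (r x)] :
    ∑ τ ∈ Fintype.piFinset (fun _ : Fin t ↦ Y), #{x ∈ B | ∀ j, r x (τ j)} =
      ∑ x ∈ B, #{z ∈ Y | r x z} ^ t := by
  classical
  rw [show ∑ τ ∈ Fintype.piFinset (fun _ : Fin t ↦ Y), #{x ∈ B | ∀ j, r x (τ j)} =
      ∑ x ∈ B, #{τ ∈ Fintype.piFinset (fun _ : Fin t ↦ Y) | ∀ j, r x (τ j)} from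
    sum_card_bipartiteAbove_eq_sum_card_bipartiteBelow
      (fun (τ : Fin t → W) (x : β) ↦ ∀ j, r x (τ j))]
  refine sum_congr rfl fun x _ ↦ ?_
  have : ({τ ∈ Fintype.piFinset (fun _ : Fin t ↦ Y) | ∀ j, r x (τ j)} : Finset (Fin t → W)) =
      Fintype.piFinset (fun _ : Fin t ↦ {z ∈ Y | r x z}) := by
    ext τ
    simp only [mem_filter, Fintype.mem_piFinset, forall_and]
  rw [this, Fintype.card_piFinset_const]

open Finset in
theorem sum_update_sub {ι : Type*} [Fintype ι] [DecidableEq ι] (w : ι → ℕ) (c : ι) {a : ℕ}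
    (ha : a ≤ w c) : ∑ i, Function.update w c (w c - a) i = ∑ i, w i - a := by
  rw [sum_update_of_mem (mem_univ c), sum_eq_add_sum_sdiff_singleton_of_mem (mem_univ c) w]
  omega

/-! ### Dependent random choice -/

namespace SimpleGraph

variable {W : Type*}

open Classical in
/-- The vertices of `Y` that are equal or adjacent to every element of `S`. Allowing equality makes
the degrees of the colors at a vertex of `Y` add up to at least `#Y`; an embedding that avoids the
vertices already used never notices the difference. -/
noncomputable def closedCommonNbrs (G : SimpleGraph W) (Y : Finset W) (S : Set W) : Finset W :=
  {z ∈ Y | ∀ x ∈ S, x = z ∨ G.Adj x z}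

theorem mem_closedCommonNbrs {G : SimpleGraph W} {Y : Finset W} {S : Set W} {z : W} :
    z ∈ G.closedCommonNbrs Y S ↔ z ∈ Y ∧ ∀ x ∈ S, x = z ∨ G.Adj x z := by
  classical
  simp [closedCommonNbrs]

/-- Every set of at most `D` vertices of `Y'` has at least `b` common neighbors in `Y`, in the
sense of `closedCommonNbrs`. -/
def IsRichIn (G : SimpleGraph W) (D b : ℕ) (Y' Y : Finset W) : Prop :=
  ∀ S : Finset W, S ⊆ Y' → S.card ≤ D → b ≤ (G.closedCommonNbrs Y S).card

open Finset in
/-- Dependent random choice: `Y'` is the common neighborhood of a random `(D + 1)`-tuple of `Y`,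
with one vertex removed from each `D`-tuple that has fewer than `b` common neighbors. Such a
`D`-tuple survives with probability less than `(b / #Y) ^ (D + 1)`, so that fewer than one of them
is expected, and since sizes are integers the deletion costs nothing. -/
theorem exists_isRichIn_of_sum_pow (G : SimpleGraph W) (Y : Finset W) {D b k Q : ℕ} (hD : 0 < D)
    (hY : #Y = k ^ (D + 1) * Q) (hb : b ^ (D + 1) < #Y)
    (hdeg : #Y * (k ^ D * Q) ^ (D + 1) ≤ ∑ x ∈ Y, #(G.closedCommonNbrs Y {x}) ^ (D + 1)) :
    ∃ Y' ⊆ Y, Q ≤ #Y' ∧ G.IsRichIn D b Y' Y := by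
  classical
  set T := Fintype.piFinset (fun _ : Fin (D + 1) ↦ Y)
  set B : Finset (Fin D → W) := {σ ∈ Fintype.piFinset (fun _ : Fin D ↦ Y) |
    #(G.closedCommonNbrs Y (Set.range σ)) < b}
  have hYpos : 0 < #Y := by omega
  have hT : #T = #Y ^ (D + 1) := Fintype.card_piFinset_const _ _
  -- the total size of the common neighborhoods of all tuples `τ`
  have h1 : ∑ τ ∈ T, #{x ∈ Y | ∀ j, x = τ j ∨ G.Adj x (τ j)} =
      ∑ x ∈ Y, #(G.closedCommonNbrs Y {x}) ^ (D + 1) := by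
    rw [sum_piFinset_card_filter_forall (D + 1) Y Y fun x z ↦ x = z ∨ G.Adj x z]
    simp [closedCommonNbrs]
  -- the total number of bad `D`-tuples inside these neighborhoods
  have h2 : ∑ τ ∈ T, #{σ ∈ B | ∀ j, ∀ i, σ i = τ j ∨ G.Adj (σ i) (τ j)} ≤
      #Y ^ D * b ^ (D + 1) := by
    rw [sum_piFinset_card_filter_forall (D + 1) B Y fun (σ : Fin D → W) z ↦
      ∀ i, σ i = z ∨ G.Adj (σ i) z]
    calc _ ≤ ∑ σ ∈ B, b ^ (D + 1) := by
          refine sum_le_sum fun σ hσ ↦ Nat.pow_le_pow_left ?_ _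
          have := (mem_filter.1 hσ).2.le
          simpa [closedCommonNbrs] using this
      _ = #B * b ^ (D + 1) := by simp
      _ ≤ _ := by
          refine Nat.mul_le_mul_right _ ((card_filter_le _ _).trans_eq ?_)
          exact Fintype.card_piFinset_const _ _
  have h3 : ∃ τ ∈ T, Q + #{σ ∈ B | ∀ j, ∀ i, σ i = τ j ∨ G.Adj (σ i) (τ j)} <
      #{x ∈ Y | ∀ j, x = τ j ∨ G.Adj x (τ j)} + 1 := by
    refine exists_lt_of_sum_lt ?_
    rw [sum_add_distrib, sum_add_distrib, h1, sum_const, sum_const, smul_eq_mul, smul_eq_mul, hT,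
      mul_one]
    have h4 : #Y ^ D * b ^ (D + 1) < #Y ^ (D + 1) := by
      calc _ < #Y ^ D * #Y := Nat.mul_lt_mul_of_pos_left hb (by positivity)
        _ = _ := (pow_succ _ _).symm
    have h5 : #Y * (k ^ D * Q) ^ (D + 1) = #Y ^ (D + 1) * Q := by
      rw [hY]; ring
    omega
  obtain ⟨τ, hτ, hτQ⟩ := h3
  set N : Finset W := {x ∈ Y | ∀ j, x = τ j ∨ G.Adj x (τ j)}
  set E : Finset (Fin D → W) := {σ ∈ B | ∀ j, ∀ i, σ i = τ j ∨ G.Adj (σ i) (τ j)}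
  have hN := le_card_sdiff (E.image fun σ ↦ σ ⟨0, hD⟩) N
  have hE := card_image_le (f := fun σ : Fin D → W ↦ σ ⟨0, hD⟩) (s := E)
  refine ⟨N \ E.image fun σ ↦ σ ⟨0, hD⟩, sdiff_subset.trans (filter_subset _ _), by omega,
    fun S hS hSD ↦ ?_⟩
  rcases S.eq_empty_or_nonempty with rfl | hne
  · have : b ≤ b ^ (D + 1) := Nat.le_self_pow (by omega) b
    have h8 : G.closedCommonNbrs Y ((∅ : Finset W) : Set W) = Y := by simp [closedCommonNbrs]
    rw [h8]
    omega
  -- `S` is the set of entries of some `D`-tuple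
  obtain ⟨σ, hσ⟩ : ∃ σ : Fin D → W, Set.range σ = S := by
    have : Nonempty S := hne.to_subtype
    obtain ⟨e⟩ : Nonempty (S ↪ Fin D) :=
      Function.Embedding.nonempty_of_card_le (by simpa using hSD)
    refine ⟨fun i ↦ (Function.invFun e i : S), ?_⟩
    have := (Function.invFun_surjective e.injective).range_comp (fun x : S ↦ (x : W))
    simpa [Function.comp_def] using this
  have hmem (i : Fin D) : σ i ∈ S := by
    rw [← mem_coe, ← hσ]; exact Set.mem_range_self i
  by_contra! hlt
  rw [← hσ] at hlt
  have hσS := hS (hmem ⟨0, hD⟩)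
  rw [mem_sdiff] at hσS
  refine hσS.2 (mem_image_of_mem _ (mem_filter.2 ⟨mem_filter.2 ⟨?_, hlt⟩, fun j i ↦ ?_⟩))
  · rw [Fintype.mem_piFinset]
    intro i
    have := hS (hmem i)
    simp only [N, mem_sdiff, mem_filter] at this
    exact this.1.1
  · have := hS (hmem i)
    simp only [N, mem_sdiff, mem_filter] at this
    exact this.1.2 j

open Finset in
/-- If the colors in `C` have average degree at least `#Y / k` in `Y`, then dependent random choice
works for one of them. -/
theorem exists_color_isRichIn {ι : Type*} (G : ι → SimpleGraph W) (C : Finset ι) (hC : C.Nonempty)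
    (Y : Finset W) {D b k Q : ℕ} (hD : 0 < D) (hY : #Y = k ^ (D + 1) * Q)
    (hb : b ^ (D + 1) < #Y)
    (hdeg : ∀ x ∈ Y, #C * (k ^ D * Q) ≤ ∑ c ∈ C, #((G c).closedCommonNbrs Y {x})) :
    ∃ c ∈ C, ∃ Y' ⊆ Y, Q ≤ #Y' ∧ (G c).IsRichIn D b Y' Y := by
  set P := k ^ D * Q
  have hYpos : 0 < #Y := by omega
  suffices ∃ c ∈ C, #Y * P ^ (D + 1) ≤ ∑ x ∈ Y, #((G c).closedCommonNbrs Y {x}) ^ (D + 1) by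
    obtain ⟨c, hc, h⟩ := this
    exact ⟨c, hc, exists_isRichIn_of_sum_pow (G c) Y hD hY hb h⟩
  refine exists_le_of_sum_le hC ?_
  rw [sum_const, smul_eq_mul,
    ← sum_product' C Y fun c x ↦ #((G c).closedCommonNbrs Y {x}) ^ (D + 1)]
  have h1 : #C * #Y * P ≤ ∑ p ∈ C ×ˢ Y, #((G p.1).closedCommonNbrs Y {p.2}) := by
    rw [sum_product_right]
    calc _ = ∑ x ∈ Y, #C * P := by rw [sum_const, smul_eq_mul]; ring
      _ ≤ _ := sum_le_sum hdeg
  -- the power mean inequality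
  have h2 := pow_sum_le_card_mul_sum_pow (s := C ×ˢ Y)
    (f := fun p ↦ #((G p.1).closedCommonNbrs Y {p.2})) (fun _ _ ↦ Nat.zero_le _) D
  have h3 : 0 < #C * #Y := Nat.mul_pos hC.card_pos hYpos
  rw [card_product, Nat.cast_id] at h2
  refine Nat.le_of_mul_le_mul_left (le_trans ?_ h2) (pow_pos h3 D)
  calc (#C * #Y) ^ D * (#C * (#Y * P ^ (D + 1))) = (#C * #Y * P) ^ (D + 1) := by ring
    _ ≤ _ := Nat.pow_le_pow_left h1 _

/-! ### Growing the structure in all colors -/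

/-- A chain `X ⊇ Y₀ ⊇ Y₁ ⊇ ⋯ ⊇ Y_q = Y` in which every `Yᵢ₊₁` is rich in `Yᵢ`. -/
inductive Tower (G : SimpleGraph W) (D b : ℕ) : ℕ → Finset W → Finset W → Prop
  | base {X Y : Finset W} : Y ⊆ X → Tower G D b 0 X Y
  | step {q : ℕ} {X Y Z : Finset W} :
      Tower G D b q X Y → Z ⊆ Y → G.IsRichIn D b Z Y → Tower G D b (q + 1) X Z

theorem IsRichIn.mono {G : SimpleGraph W} {D b : ℕ} {X Y Z : Finset W} (h : G.IsRichIn D b Y X)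
    (hZ : Z ⊆ Y) : G.IsRichIn D b Z X :=
  fun S hS ↦ h S (hS.trans hZ)

theorem Tower.mono {G : SimpleGraph W} {D b q : ℕ} {X Y Z : Finset W} (h : Tower G D b q X Y)
    (hZ : Z ⊆ Y) : Tower G D b q X Z := by
  cases h with
  | base h => exact .base (hZ.trans h)
  | step h hY hr => exact .step h (hZ.trans hY) (hr.mono hZ)

/-- The progress of one color `G` at the current vertex set `Y`; the steps still to be made for this
color cost `w` in total, at a price of `1` for a vertex of the clique and `D + 1` for a level of the
tower. Either a clique `K` joined to all of
`Y` has been found, with `r` vertices to go until it has `s`, or the clique is complete and `i` out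
of `D` levels of a tower below a set joined to it have been built. -/
def IsStage (G : SimpleGraph W) (D b s w : ℕ) (Y : Finset W) : Prop :=
  (∃ (K : Finset W) (r : ℕ), G.IsClique K ∧ K.card + r = s ∧ (∀ x ∈ K, ∀ y ∈ Y, G.Adj x y) ∧
    w = r + (D + 1) * D) ∨
  ∃ (K X : Finset W) (i j : ℕ), G.IsClique K ∧ K.card = s ∧ (∀ x ∈ K, ∀ y ∈ X, G.Adj x y) ∧
    Tower G D b i X Y ∧ i + j = D ∧ w = (D + 1) * j

theorem IsStage.mono {G : SimpleGraph W} {D b s w : ℕ} {Y Z : Finset W}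
    (h : G.IsStage D b s w Y) (hZ : Z ⊆ Y) : G.IsStage D b s w Z := by
  obtain ⟨K, r, hK, hr, hadj, hw⟩ | ⟨K, X, i, j, hK, hs, hadj, ht, hij, hw⟩ := h
  · exact .inl ⟨K, r, hK, hr, fun x hx y hy ↦ hadj x hx y (hZ hy), hw⟩
  · exact .inr ⟨K, X, i, j, hK, hs, hadj, ht.mono hZ, hij, hw⟩

theorem isStage_start (G : SimpleGraph W) (D b s : ℕ) (Y : Finset W) :
    G.IsStage D b s (s + (D + 1) * D) Y :=
  .inl ⟨∅, s, by simp, by simp, by simp, rfl⟩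

/-- A color that is not finished makes progress either at the neighborhood of any vertex, or at any
rich subset. -/
theorem IsStage.step {G : SimpleGraph W} {D b s w : ℕ} {Y : Finset W}
    (h : G.IsStage D b s w Y) (hw : 0 < w) :
    (∀ v ∈ Y, ∀ Z ⊆ Y, (∀ z ∈ Z, G.Adj v z) → G.IsStage D b s (w - 1) Z) ∨
      (D + 1 ≤ w ∧ ∀ Z ⊆ Y, G.IsRichIn D b Z Y → G.IsStage D b s (w - (D + 1)) Z) := by
  classical
  have key (K X : Finset W) (i j : ℕ) (hK : G.IsClique K) (hs : K.card = s)
      (hadj : ∀ x ∈ K, ∀ y ∈ X, G.Adj x y) (ht : Tower G D b i X Y) (hij : i + j = D)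
      (hwj : w = (D + 1) * j) :
      D + 1 ≤ w ∧ ∀ Z ⊆ Y, G.IsRichIn D b Z Y → G.IsStage D b s (w - (D + 1)) Z := by
    obtain _ | j := j
    · simp [hwj] at hw
    · rw [mul_add_one] at hwj
      exact ⟨by omega, fun Z hZ hr ↦ .inr ⟨K, X, i + 1, j, hK, hs, hadj, ht.step hZ hr, by omega,
        by omega⟩⟩
  obtain ⟨K, r, hK, hr, hadj, hwr⟩ | ⟨K, X, i, j, hK, hs, hadj, ht, hij, hwj⟩ := h
  · obtain _ | r := r
    · exact .inr (key K Y 0 D hK (by omega) hadj (.base subset_rfl) (by omega) (by omega))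
    · refine .inl fun v hv Z hZ hvZ ↦ .inl ⟨insert v K, r, ?_, ?_, ?_, by omega⟩
      · rw [Finset.coe_insert]
        exact hK.insert fun x hx _ ↦ (hadj x hx v hv).symm
      · rw [Finset.card_insert_of_notMem fun hvK ↦ G.loopless.irrefl v (hadj v hvK v hv)]
        omega
      · intro x hx y hy
        obtain rfl | hx := Finset.mem_insert.1 hx
        · exact hvZ y hy
        · exact hadj x hx y (hZ hy)
  · exact .inr (key K X i j hK hs hadj ht hij hwj)

open Finset in
/-- At a vertex of `Y` the closed degrees in all colors together count every other vertex of `Y`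
at least once and the vertex itself once for each color. -/
theorem card_add_card_le_sum_closedCommonNbrs {ι : Type*} [Fintype ι] (G : ι → SimpleGraph W)
    (hG : ∀ x y, x ≠ y → ∃ c, (G c).Adj x y) {Y : Finset W} {v : W} (hv : v ∈ Y) :
    #Y + Fintype.card ι ≤ ∑ c, #((G c).closedCommonNbrs Y {v}) + 1 := by
  classical
  have h1 (c : ι) : #((G c).closedCommonNbrs Y {v}) = #{z ∈ Y | (G c).Adj v z} + 1 := by
    rw [← card_insert_of_notMem (a := v) (by simp)]
    congr 1
    ext z
    simp only [mem_closedCommonNbrs, Set.mem_singleton_iff, forall_eq, mem_insert, mem_filter]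
    grind
  have h2 : Y.erase v ⊆ univ.biUnion fun c ↦ {z ∈ Y | (G c).Adj v z} := by
    intro z hz
    obtain ⟨c, hc⟩ := hG v z (ne_of_mem_erase hz).symm
    exact mem_biUnion.2 ⟨c, mem_univ c, mem_filter.2 ⟨mem_of_mem_erase hz, hc⟩⟩
  have h3 := (card_le_card h2).trans card_biUnion_le
  rw [card_erase_of_mem hv] at h3
  simp only [h1, sum_add_distrib, sum_const, card_univ, smul_eq_mul, mul_one]
  omega

open Finset in
/-- If no color that profits from a large neighborhood has one, the remaining colors have large
average degree at every vertex, and dependent random choice finds a rich subset for one of them.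
So some color always makes progress at its price, and the total price is `∑ c, w c`. -/
theorem exists_isStage_zero {ι : Type*} [Fintype ι] (G : ι → SimpleGraph W)
    (hG : ∀ x y, x ≠ y → ∃ c, (G c).Adj x y) {D b s M : ℕ} (hι : 2 ≤ Fintype.card ι) (hD : 0 < D)
    (hM : 0 < M) (hbM : b ^ (D + 1) ≤ M) (n : ℕ) (w : ι → ℕ) (Y : Finset W) (hw : ∑ c, w c = n)
    (hY : Fintype.card ι ^ n * M ≤ #Y) (hst : ∀ c, (G c).IsStage D b s (w c) Y) :
    ∃ c, ∃ Z : Finset W, (G c).IsStage D b s 0 Z ∧ M ≤ #Z := by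
  classical
  induction n using Nat.strong_induction_on generalizing w Y with
  | _ n ih =>
  set k := Fintype.card ι
  by_cases h0 : ∃ c, w c = 0
  · obtain ⟨c, hc⟩ := h0
    exact ⟨c, Y, hc ▸ hst c, (Nat.le_mul_of_pos_left M (by positivity)).trans hY⟩
  push Not at h0
  obtain ⟨Y, hYsub, hY⟩ := exists_subset_card_eq hY
  replace hst c := (hst c).mono hYsub
  have hwn (c : ι) : w c ≤ n := hw ▸ single_le_sum (fun _ _ ↦ Nat.zero_le _) (mem_univ c)
  -- it suffices to make progress in one color
  have next (c : ι) (a : ℕ) (ha : 0 < a) (haw : a ≤ w c) (Z : Finset W) (hZ : Z ⊆ Y)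
      (hZc : k ^ (n - a) * M ≤ #Z) (hstZ : (G c).IsStage D b s (w c - a) Z) :
      ∃ c, ∃ Z : Finset W, (G c).IsStage D b s 0 Z ∧ M ≤ #Z := by
    refine ih (n - a) (by have := hwn c; omega) (Function.update w c (w c - a)) Z
      (by rw [sum_update_sub w c haw, hw]) hZc fun i ↦ ?_
    obtain rfl | hi := eq_or_ne i c
    · rwa [Function.update_self]
    · rw [Function.update_of_ne hi]
      exact (hst i).mono hZ
  set C : Finset ι := {c | D + 1 ≤ w c ∧
    ∀ Z ⊆ Y, (G c).IsRichIn D b Z Y → (G c).IsStage D b s (w c - (D + 1)) Z}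
  set P := k ^ (n - 1) * M
  by_cases hv : ∃ v ∈ Y, ∃ c ∉ C, P ≤ #{z ∈ Y | (G c).Adj v z}
  · obtain ⟨v, hvY, c, hc, hP⟩ := hv
    refine next c 1 one_pos (Nat.pos_of_ne_zero (h0 c)) _ (filter_subset _ _) hP ?_
    obtain h | h := (hst c).step (Nat.pos_of_ne_zero (h0 c))
    · exact h v hvY _ (filter_subset _ _) fun z hz ↦ (mem_filter.1 hz).2
    · exact absurd (mem_filter.2 ⟨mem_univ c, h⟩) hc
  push Not at hv
  have hne : Nonempty ι := Fintype.card_pos_iff.1 (by omega)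
  have hn : 0 < n := (Nat.pos_of_ne_zero (h0 hne.some)).trans_le (hwn _)
  have hYP : #Y = k * P := by
    rw [hY, ← mul_assoc, ← pow_succ', Nat.sub_add_cancel hn]
  have hdeg : ∀ v ∈ Y, #C * P + 1 ≤ ∑ c ∈ C, #((G c).closedCommonNbrs Y {v}) := by
    intro v hvY
    have h1 := card_add_card_le_sum_closedCommonNbrs G hG hvY
    have h2 : ∑ c ∈ Cᶜ, #((G c).closedCommonNbrs Y {v}) ≤ #Cᶜ * P := by
      rw [← smul_eq_mul, ← sum_const]
      refine sum_le_sum fun c hc ↦ ?_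
      have h3 : (G c).closedCommonNbrs Y {v} ⊆ insert v {z ∈ Y | (G c).Adj v z} := by
        intro z
        simp only [mem_closedCommonNbrs, Set.mem_singleton_iff, forall_eq, mem_insert, mem_filter]
        grind
      have h4 := (card_le_card h3).trans (card_insert_le _ _)
      have h5 := hv v hvY c (mem_compl.1 hc)
      omega
    have h6 : #C * P + #Cᶜ * P = k * P := by rw [← add_mul, card_add_card_compl]
    rw [← sum_add_sum_compl C] at h1
    omega
  have hP : 0 < P := by positivity
  have hYne : Y.Nonempty := card_pos.1 (by rw [hY]; positivity)
  have hC : C.Nonempty := by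
    obtain ⟨v, hvY⟩ := hYne
    by_contra! hC
    simpa [hC] using hdeg v hvY
  obtain ⟨c₀, hc₀⟩ := hC
  have hDn : D + 1 ≤ n := (mem_filter.1 hc₀).2.1.trans (hwn c₀)
  have hQ : k ^ D * (k ^ (n - (D + 1)) * M) = P := by
    rw [← mul_assoc, ← pow_add]; congr 2; omega
  obtain ⟨c, hc, Z, hZ, hZc, hr⟩ := exists_color_isRichIn G C ⟨c₀, hc₀⟩ Y
    (b := b) (k := k) (Q := k ^ (n - (D + 1)) * M) hD
    (by rw [hYP, ← hQ]; ring)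
    (by
      refine hbM.trans_lt ?_
      rw [hY]
      exact lt_mul_of_one_lt_left hM (Nat.one_lt_pow hn.ne' hι))
    (fun v hvY ↦ by rw [hQ]; exact (Nat.le_succ _).trans (hdeg v hvY))
  have hc' := (mem_filter.1 hc).2
  exact next c (D + 1) (Nat.succ_pos D) hc'.1 Z hZ hZc (hc'.2 Z hZ hr)

/-! ### Embedding the graph -/

variable {V : Type*}

open Finset in
theorem exists_greedy_coloring (F : SimpleGraph V) [DecidableRel F.Adj] {D : ℕ} (U : Finset V)
    (hU : ∀ u ∈ U, #{v ∈ U | F.Adj u v} ≤ D) :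
    ∃ col : V → ℕ, (∀ u, col u ≤ D) ∧ ∀ u ∈ U, ∀ v ∈ U, F.Adj u v → col u ≠ col v := by
  classical
  induction U using Finset.induction_on with
  | empty => exact ⟨fun _ ↦ 0, by simp⟩
  | insert a U ha ih =>
    obtain ⟨col, hle, hcol⟩ := ih fun u hu ↦ (card_le_card
      (filter_subset_filter _ (subset_insert a U))).trans (hU u (mem_insert_of_mem hu))
    obtain ⟨i, hi, hia⟩ : ∃ i ∈ range (D + 1), i ∉ image col {v ∈ U | F.Adj a v} := by
      refine exists_mem_notMem_of_card_lt_card ?_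
      rw [card_range]
      have h1 : #{v ∈ U | F.Adj a v} ≤ #{v ∈ insert a U | F.Adj a v} :=
      card_le_card (filter_subset_filter _ (subset_insert a U))
      have h2 := hU a (mem_insert_self a U)
      have h3 := card_image_le (f := col) (s := {v ∈ U | F.Adj a v})
      omega
    simp only [mem_image, mem_filter, not_exists, not_and, and_imp] at hia
    refine ⟨Function.update col a i, fun u ↦ ?_, fun u hu v hv huv ↦ ?_⟩
    · obtain rfl | h := eq_or_ne u a
      · simpa [Nat.lt_succ_iff] using hi
      · simpa [h] using hle u
    · have hne := huv.ne
      rcases mem_insert.1 hu with rfl | hu' <;> rcases mem_insert.1 hv with rfl | hv'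
      · exact absurd rfl hne
      · rw [Function.update_self, Function.update_of_ne hne.symm]
        exact fun h ↦ hia v hv' huv h.symm
      · rw [Function.update_self, Function.update_of_ne hne]
        exact hia u hu' huv.symm
      · rw [Function.update_of_ne (ne_of_mem_of_not_mem hu' ha),
          Function.update_of_ne (ne_of_mem_of_not_mem hv' ha)]
        exact hcol u hu' v hv' huv

/-- `f` embeds the subgraph of `F` induced on `U` into `G`, with image in `Y`. -/
structure IsEmbOn (F : SimpleGraph V) (G : SimpleGraph W) (U : Finset V) (f : V → W)
    (Y : Finset W) : Prop where
  mem : ∀ u ∈ U, f u ∈ Y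
  injOn : Set.InjOn f U
  adj : ∀ u ∈ U, ∀ v ∈ U, F.Adj u v → G.Adj (f u) (f v)

open Finset in
/-- The new vertices `I` form an independent set, so that each of them only has to be mapped to a
common neighbor of at most `D` elements of `Z`, of which there are more than are in use. -/
theorem IsEmbOn.exists_union {F : SimpleGraph V} [DecidableRel F.Adj] [DecidableEq V]
    {G : SimpleGraph W} {D b : ℕ} {Y Z : Finset W} {U I : Finset V} {f : V → W}
    (hf : IsEmbOn F G U f Z) (hZ : Z ⊆ Y) (hr : G.IsRichIn D b Z Y)
    (hI : ∀ u ∈ I, ∀ v ∈ I, ¬ F.Adj u v) (hUI : Disjoint U I)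
    (hdeg : ∀ u ∈ I, #{v ∈ U | F.Adj u v} ≤ D) (hb : #(U ∪ I) ≤ b) :
    ∃ g, IsEmbOn F G (U ∪ I) g Y ∧ ∀ u ∈ U, g u = f u := by
  classical
  induction I using Finset.induction_on with
  | empty =>
    rw [union_empty]
    exact ⟨f, ⟨fun u hu ↦ hZ (hf.mem u hu), hf.injOn, hf.adj⟩, fun _ _ ↦ rfl⟩
  | insert a I ha ih =>
    rw [disjoint_insert_right] at hUI
    rw [union_insert] at hb ⊢
    have haUI : a ∉ U ∪ I := by simp [hUI.1, ha]
    rw [card_insert_of_notMem haUI] at hb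
    obtain ⟨g, hg, hgf⟩ := ih
      (fun u hu v hv ↦ hI u (mem_insert_of_mem hu) v (mem_insert_of_mem hv)) hUI.2
      (fun u hu ↦ hdeg u (mem_insert_of_mem hu)) (by omega)
    obtain ⟨z, hz, hzg⟩ : ∃ z ∈ G.closedCommonNbrs Y ({v ∈ U | F.Adj a v}.image f),
        z ∉ (U ∪ I).image g := by
      refine exists_mem_notMem_of_card_lt_card ?_
      refine (card_image_le.trans_lt hb).trans_le (hr _ ?_ ?_)
      · intro x hx
        obtain ⟨v, hv, rfl⟩ := mem_image.1 hx
        exact hf.mem v (mem_filter.1 hv).1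
      · exact card_image_le.trans (hdeg a (mem_insert_self a I))
    rw [mem_closedCommonNbrs] at hz
    have hzg' (v) (hv : v ∈ U ∪ I) : g v ≠ z := fun h ↦ hzg (h ▸ mem_image_of_mem g hv)
    have hga (v) (hv : v ∈ U ∪ I) : Function.update g a z v = g v :=
      Function.update_of_ne (ne_of_mem_of_not_mem hv haUI) _ _
    -- a neighbor of the new vertex `a` lies in `U`, and its image is adjacent to `z`
    have hadj (v) (hv : v ∈ U ∪ I) (hav : F.Adj a v) : G.Adj (g v) z := by
      have hvU : v ∈ U := (mem_union.1 hv).resolve_right fun hvI ↦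
        hI a (mem_insert_self a I) v (mem_insert_of_mem hvI) hav
      have := hz.2 (f v) (mem_coe.2 (mem_image_of_mem f (mem_filter.2 ⟨hvU, hav⟩)))
      rw [← hgf v hvU] at this
      exact this.resolve_left (hzg' v hv)
    refine ⟨Function.update g a z, ⟨fun u hu ↦ ?_, ?_, fun u hu v hv huv ↦ ?_⟩, fun u hu ↦ ?_⟩
    · rcases mem_insert.1 hu with rfl | hu'
      · simpa using hz.1
      · rw [hga u hu']; exact hg.mem u hu'
    · intro u hu v hv huv
      rcases mem_insert.1 hu with rfl | hu' <;> rcases mem_insert.1 hv with rfl | hv'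
      · rfl
      · rw [Function.update_self, hga v hv'] at huv
        exact absurd huv.symm (hzg' v hv')
      · rw [Function.update_self, hga u hu'] at huv
        exact absurd huv (hzg' u hu')
      · rw [hga u hu', hga v hv'] at huv
        exact hg.injOn hu' hv' huv
    · rcases mem_insert.1 hu with rfl | hu' <;> rcases mem_insert.1 hv with rfl | hv'
      · exact absurd rfl huv.ne
      · rw [Function.update_self, hga v hv']
        exact (hadj v hv' huv).symm
      · rw [Function.update_self, hga u hu']
        exact hadj u hu' huv.symm
      · rw [hga u hu', hga v hv']
        exact hg.adj u hu' v hv' huv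
    · rw [hga u (mem_union_left I hu), hgf u hu]

open Finset in
/-- Climbing a tower, one color class of a proper coloring of `F` is embedded at each level. -/
theorem Tower.exists_isEmbOn {F : SimpleGraph V} [DecidableRel F.Adj] {G : SimpleGraph W}
    {D b q : ℕ} {X Y : Finset W} (hT : Tower G D b q X Y) {U : Finset V} {col : V → ℕ}
    (hcol : ∀ u ∈ U, ∀ v ∈ U, F.Adj u v → col u ≠ col v)
    (hdeg : ∀ u ∈ U, #{v ∈ U | F.Adj u v} ≤ D) (hb : #U ≤ b)
    {f : V → W} (hf : IsEmbOn F G {u ∈ U | q ≤ col u} f Y) : ∃ g, IsEmbOn F G U g X := by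
  classical
  induction hT generalizing f with
  | base h =>
    simp only [Nat.zero_le, filter_true] at hf
    exact ⟨f, fun u hu ↦ h (hf.mem u hu), hf.injOn, hf.adj⟩
  | @step q X Y Z hT hZ hr ih =>
    have hunion : {u ∈ U | q + 1 ≤ col u} ∪ {u ∈ U | col u = q} = {u ∈ U | q ≤ col u} := by
      ext u; simp only [mem_union, mem_filter]; grind
    obtain ⟨g, hg, -⟩ := hf.exists_union (I := {u ∈ U | col u = q}) hZ hr
      (fun u hu v hv huv ↦ hcol u (mem_filter.1 hu).1 v (mem_filter.1 hv).1 huv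
        ((mem_filter.1 hu).2.trans (mem_filter.1 hv).2.symm))
      (disjoint_filter.2 fun _ _ h h' ↦ by omega)
      (fun u hu ↦ (card_le_card (filter_subset_filter _ (filter_subset _ _))).trans
        (hdeg u (mem_filter.1 hu).1))
      (by rw [hunion]; exact (card_filter_le _ _).trans hb)
    rw [hunion] at hg
    exact ih hg

open Finset in
/-- A finished color contains `F`: the vertices of degree greater than `D` go to the clique, and
the rest is embedded along the tower. -/
theorem IsStage.isContained [Fintype V] {F : SimpleGraph V} [DecidableRel F.Adj]
    {G : SimpleGraph W} {D b : ℕ} {Y : Finset W} (hD : 0 < D) (hb0 : 0 < b)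
    (hb : Fintype.card V ≤ b) (hY : b ≤ #Y)
    (h : G.IsStage D b #{v | D < F.degree v} 0 Y) : F.IsContained G := by
  classical
  obtain ⟨-, r, -, -, -, hr⟩ | ⟨K, X, i, j, hK, hs, hKX, hT, hij, hj⟩ := h
  · have : 0 < (D + 1) * D := by positivity
    omega
  obtain rfl : j = 0 := by simpa using hj.symm
  obtain rfl : i = D := by simpa using hij
  set A : Finset V := {v | i < F.degree v}
  have hdeg : ∀ u ∈ Aᶜ, #{v ∈ Aᶜ | F.Adj u v} ≤ i := by
    intro u hu
    have h1 : F.degree u ≤ i := by simpa [A] using hu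
    refine (card_le_card fun v hv ↦ ?_).trans h1
    simpa using (mem_filter.1 hv).2
  obtain ⟨col, hle, hcol⟩ := F.exists_greedy_coloring Aᶜ hdeg
  have hYne : Y.Nonempty := card_pos.1 (hb0.trans_le hY)
  -- a further level, below `Y`, whose bottom is empty: the last color class is free in `Y`
  have hT' : Tower G i b (i + 1) X ∅ := by
    refine hT.step (empty_subset Y) fun S hS _ ↦ ?_
    obtain rfl := subset_empty.1 hS
    simpa [closedCommonNbrs] using hY
  have hempty : ({u ∈ Aᶜ | i + 1 ≤ col u} : Finset V) = ∅ :=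
    filter_eq_empty_iff.2 fun u _ ↦ by have := hle u; omega
  obtain ⟨g, hg⟩ := hT'.exists_isEmbOn hcol hdeg ((card_le_univ _).trans hb)
    (f := fun _ ↦ hYne.choose) (by rw [hempty]; exact ⟨by simp, by simp, by simp⟩)
  obtain ⟨e⟩ : Nonempty (A ≃ K) := by rw [← Fintype.card_eq]; simp [hs]
  have hdisj (x) (hx : x ∈ K) (y) (hy : y ∈ X) : x ≠ y := (hKX x hx y hy).ne
  let f : V → W := fun v ↦ if hv : v ∈ A then e ⟨v, hv⟩ else g v
  have hfA (v) (hv : v ∈ A) : f v = e ⟨v, hv⟩ := dif_pos hv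
  have hfB (v) (hv : v ∉ A) : f v = g v := dif_neg hv
  have hgX (v) (hv : v ∉ A) : g v ∈ X := hg.mem v (mem_compl.2 hv)
  have hinj : Function.Injective f := by
    intro u v huv
    by_cases hu : u ∈ A <;> by_cases hv : v ∈ A
    · rw [hfA u hu, hfA v hv] at huv
      simpa using e.injective (Subtype.ext huv)
    · rw [hfA u hu, hfB v hv] at huv
      exact absurd huv (hdisj _ (e ⟨u, hu⟩).2 _ (hgX v hv))
    · rw [hfB u hu, hfA v hv] at huv
      exact absurd huv.symm (hdisj _ (e ⟨v, hv⟩).2 _ (hgX u hu))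
    · rw [hfB u hu, hfB v hv] at huv
      exact hg.injOn (by simpa using hu) (by simpa using hv) huv
  refine ⟨⟨⟨f, fun {u v} huv ↦ ?_⟩, hinj⟩⟩
  by_cases hu : u ∈ A <;> by_cases hv : v ∈ A
  · rw [hfA u hu, hfA v hv]
    refine hK (e ⟨u, hu⟩).2 (e ⟨v, hv⟩).2 ?_
    rw [← hfA u hu, ← hfA v hv]
    exact hinj.ne huv.ne
  · rw [hfA u hu, hfB v hv]
    exact hKX _ (e ⟨u, hu⟩).2 _ (hgX v hv)
  · rw [hfB u hu, hfA v hv]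
    exact (hKX _ (e ⟨v, hv⟩).2 _ (hgX u hu)).symm
  · rw [hfB u hu, hfB v hv]
    exact hg.adj u (mem_compl.2 hu) v (mem_compl.2 hv) huv

open Finset in
theorem ramseyArrows_of_card_le [Fintype V] (F : SimpleGraph V) [DecidableRel F.Adj] {k D b : ℕ}
    (hk : 2 ≤ k) (hD : 0 < D) (hb0 : 0 < b) (hb : Fintype.card V ≤ b) :
    RamseyArrows k F (k ^ (k * (#{v | D < F.degree v} + (D + 1) * D)) * b ^ (D + 1)) := by
  intro C
  obtain ⟨c, Z, hc, hZ⟩ := exists_isStage_zero C.labelGraph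
    (fun x y hxy ↦ ⟨C ⟨s(x, y), hxy⟩, (EdgeLabeling.labelGraph_adj x y).2 ⟨hxy, rfl⟩⟩)
    (D := D) (b := b) (s := #{v | D < F.degree v}) (M := b ^ (D + 1)) (by simpa using hk) hD
    (by positivity) le_rfl _
    (fun _ ↦ #{v | D < F.degree v} + (D + 1) * D) univ rfl (by simp)
    (fun c ↦ isStage_start _ D b _ univ)
  exact ⟨c, hc.isContained hD hb0 hb ((Nat.le_self_pow (by omega) b).trans hZ)⟩

/-! ### Degrees and edges -/

open Finset in
theorem card_le_two_mul_card_edgeFinset [Fintype V] (F : SimpleGraph V)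
    [DecidableRel F.Adj] (hiso : ∀ v, ¬ F.IsIsolated v) :
    Fintype.card V ≤ 2 * #F.edgeFinset := by
  rw [← sum_degrees_eq_twice_card_edges, Fintype.card_eq_sum_ones]
  refine sum_le_sum fun v _ ↦ ?_
  obtain ⟨u, hu⟩ := F.exists_adj_iff_not_isIsolated.2 (hiso v)
  exact (F.degree_pos_iff_exists_adj v).2 ⟨u, hu⟩

open Finset in
theorem card_filter_lt_degree_mul_le [Fintype V] (F : SimpleGraph V)
    [DecidableRel F.Adj] (D : ℕ) :
    #{v | D < F.degree v} * (D + 1) ≤ 2 * #F.edgeFinset := by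
  rw [← sum_degrees_eq_twice_card_edges, ← smul_eq_mul]
  exact (card_nsmul_le_sum _ _ _ fun v hv ↦ (mem_filter.1 hv).2).trans
    (sum_le_sum_of_subset (filter_subset _ _))

end SimpleGraph

/-! ### The bound -/

/-- The bound on the number of vertices for `D = ⌊m ^ (1 / 3)⌋`. -/
theorem pow_mul_two_mul_pow_le_rpow {k m s : ℕ} (hk : 2 ≤ k) (hm : 0 < m)
    (hs : s * (⌊(m : ℝ) ^ (1 / 3 : ℝ)⌋₊ + 1) ≤ 2 * m) :
    ((k ^ (k * (s + (⌊(m : ℝ) ^ (1 / 3 : ℝ)⌋₊ + 1) * ⌊(m : ℝ) ^ (1 / 3 : ℝ)⌋₊)) *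
      (2 * m) ^ (⌊(m : ℝ) ^ (1 / 3 : ℝ)⌋₊ + 1) : ℕ) : ℝ) ≤
      (k : ℝ) ^ (6 * (k : ℝ) * (m : ℝ) ^ (2 / 3 : ℝ)) := by
  set y : ℝ := (m : ℝ) ^ (1 / 3 : ℝ)
  set D := ⌊y⌋₊
  have hm1 : (1 : ℝ) ≤ m := by exact_mod_cast hm
  have hk2 : (2 : ℝ) ≤ k := by exact_mod_cast hk
  have hy1 : 1 ≤ y := Real.one_le_rpow hm1 (by norm_num)
  have hy3 : y ^ 3 = m := by
    rw [← Real.rpow_natCast, ← Real.rpow_mul (by positivity)]; norm_num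
  have hy2 : (m : ℝ) ^ (2 / 3 : ℝ) = y ^ 2 := by
    rw [← Real.rpow_natCast, ← Real.rpow_mul (by positivity)]; norm_num
  have hDy : (D : ℝ) ≤ y := Nat.floor_le (by linarith)
  have hyD : y < D + 1 := Nat.lt_floor_add_one y
  have hs2 : (s : ℝ) ≤ 2 * y ^ 2 := by
    have h : (s : ℝ) * (D + 1) ≤ 2 * m := by exact_mod_cast hs
    rw [← hy3] at h
    have h' : (s : ℝ) * y ≤ s * (D + 1) := by gcongr
    nlinarith
  have hlogk : Real.log 2 ≤ Real.log k := Real.log_le_log (by norm_num) hk2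
  have hlog2 : 2 / 3 < Real.log 2 := by linarith [Real.log_two_gt_d9]
  -- `log₂ y ≤ (3 / 2) * (y - 1)`, together with `2 ≤ k ^ (k / 2)`
  have hlogm : Real.log (2 * m) ≤ k * Real.log k * ((9 * y - 7) / 4) := by
    rw [← hy3, Real.log_mul (by norm_num) (by positivity), Real.log_pow]
    have h1 := Real.log_le_sub_one_of_pos (by linarith : 0 < y)
    have h2 : 2 * Real.log 2 ≤ k * Real.log k := by gcongr
    have h3 : Real.log 2 + 3 * (y - 1) ≤ 2 * Real.log 2 * ((9 * y - 7) / 4) := by nlinarith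
    have h4 := mul_le_mul_of_nonneg_right h2 (by linarith : 0 ≤ (9 * y - 7) / 4)
    push_cast
    linarith
  have hpoly : s + (D + 1) * D + (D + 1) * ((9 * y - 7) / 4) ≤ 6 * y ^ 2 := by
    have h1 : ((D : ℝ) + 1) * D ≤ (y + 1) * y := by gcongr
    have h2 : ((D : ℝ) + 1) * ((9 * y - 7) / 4) ≤ (y + 1) * ((9 * y - 7) / 4) := by
      have : 0 ≤ (9 * y - 7) / 4 := by linarith
      gcongr
    nlinarith [sq_nonneg (y - 1)]
  rw [hy2, ← Real.log_le_log_iff (by positivity) (by positivity), Real.log_rpow (by positivity)]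
  push_cast
  rw [Real.log_mul (by positivity) (by positivity), Real.log_pow, Real.log_pow]
  push_cast
  have hkk : 0 ≤ k * Real.log k := mul_nonneg (by positivity) (by linarith)
  calc _ ≤ k * (s + (D + 1) * D) * Real.log k + (D + 1) * (k * Real.log k * ((9 * y - 7) / 4)) := by
        gcongr
    _ = k * Real.log k * (s + (D + 1) * D + (D + 1) * ((9 * y - 7) / 4)) := by ring
    _ ≤ k * Real.log k * (6 * y ^ 2) := mul_le_mul_of_nonneg_left hpoly hkk
    _ = _ := by ring

/-- The first conjunct says that the least `n` in the definition of `r_k(F)` exists. -/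
theorem mainTheorem4 {V : Type*} [Finite V] (F : SimpleGraph V) (m k : ℕ)
    (hm : F.edgeSet.ncard = m) (hiso : ∀ v : V, ¬ F.IsIsolated v) (hk : 2 ≤ k) :
    IsLeast {n : ℕ | RamseyArrows k F n} (multicolorRamseyNumber k F) ∧
      (multicolorRamseyNumber k F : ℝ) ≤ (k : ℝ) ^ (6 * (k : ℝ) * (m : ℝ) ^ (2 / 3 : ℝ)) := by
  classical
  have := Fintype.ofFinite V
  suffices ∃ N, RamseyArrows k F N ∧ (N : ℝ) ≤ (k : ℝ) ^ (6 * (k : ℝ) * (m : ℝ) ^ (2 / 3 : ℝ)) by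
    obtain ⟨N, hN, hle⟩ := this
    exact ⟨⟨Nat.sInf_mem ⟨N, hN⟩, fun n hn ↦ Nat.sInf_le hn⟩,
      (Nat.cast_le.2 (Nat.sInf_le hN)).trans hle⟩
  have hme : F.edgeFinset.card = m := by
    rw [← hm, ← SimpleGraph.coe_edgeFinset, Set.ncard_coe_finset]
  have hcard := F.card_le_two_mul_card_edgeFinset hiso
  rw [hme] at hcard
  obtain rfl | hm0 := m.eq_zero_or_pos
  · have : IsEmpty V := Fintype.card_eq_zero_iff.1 (by omega)
    refine ⟨0, fun C ↦ ⟨⟨0, by omega⟩, ⟨⟨⟨isEmptyElim, fun {a} ↦ isEmptyElim a⟩,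
      fun a ↦ isEmptyElim a⟩⟩⟩, ?_⟩
    rw [Nat.cast_zero]
    positivity
  have hD : 0 < ⌊(m : ℝ) ^ (1 / 3 : ℝ)⌋₊ :=
    Nat.floor_pos.2 (Real.one_le_rpow (by exact_mod_cast hm0) (by norm_num))
  have hs := F.card_filter_lt_degree_mul_le ⌊(m : ℝ) ^ (1 / 3 : ℝ)⌋₊
  rw [hme] at hs
  exact ⟨_, F.ramseyArrows_of_card_le hk hD (by omega) hcard,
    pow_mul_two_mul_pow_le_rpow hk hm0 hs⟩
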